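/- Let $p \ge 1$ and $n_1,\dots,n_p \ge 0$ be integers, and let $A : \mathbb{C}^{n_1}\times\cdots\times\mathbb{C}^{n_p}\to\mathbb{C}$ be a $p$-linear form that is rational, i.e. whose values at all tuples of standard basis vectors are rational numbers. For a vector $v$ let $J(v)$ denote the sum of its entries (its mass), and let $J(x^{(1)},\dots,x^{(p)})=\prod_{i} J(x^{(i)})$ be the $p$-linear form of the all-ones hypermatrix of the same format. A number $\alpha\in\mathbb{C}$ is called a mystery-value of $A$ if there are vectors $\beta^{(i)}\in\mathbb{C}^{n_i}$ with $J(\beta^{(i)})\neq 0$ for all $i$ such that, for every $1\le j\le p$ and every $x\in\mathbb{C}^{n_j}$, $$(\alpha J-A)\bigl(\beta^{(1)},\dots,\beta^{(j-1)},x,\beta^{(j+1)},\dots,\beta^{(p)}\bigr)=0 .$$ (1) Every mystery-value of $A$ is an algebraic number. (2) (Yao's claim.) Transcendental biases cannot be robustly simulated: let $(\Omega_1,\mu_1),\dots,(\Omega_q,\mu_q)$, $q\ge 0$, be finite probability spaces, let $f:\Omega_1\times\cdots\times\Omega_q\to\{H,T\}$ be a function, and suppose that the distribution of $f(\omega_1,\dots,\omega_q)$,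 for $\omega_1,\dots,\omega_q$ sampled independently from $\mu_1,\dots,\mu_q$, does not change when any single $\mu_j$ is replaced by an arbitrary probability measure on $\Omega_j$. Then the probability $\alpha$ that $f(\omega_1,\dots,\omega_q)=H$ is not transcendental. -/

import Mathlib

open MeasureTheory

/-- The mass `J(v)` of a vector: the sum of its entries. -/
def mass {m : ℕ} : (Fin m → ℂ) →ₗ[ℂ] ℂ where
  toFun v := ∑ k, v k
  map_add' v w := by simp [Finset.sum_add_distrib]
  map_smul' c v := by simp [Finset.mul_sum]

/-- The complex `p`-linear forms of format `n 0 × ⋯ × n (p - 1)`. -/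
abbrev MForm {p : ℕ} (n : Fin p → ℕ) : Type :=
  MultilinearMap ℂ (fun i : Fin p => Fin (n i) → ℂ) ℂ

/-- The entry with multi-index `k` of the hypermatrix of a multilinear form `A`, that is, the
value of `A` at the tuple of standard basis vectors given by `k`. -/
noncomputable def MForm.entry {p : ℕ} {n : Fin p → ℕ} (A : MForm n) (k : ∀ i, Fin (n i)) : ℂ :=
  A (fun i => Pi.single (k i) 1)

/-- A multilinear form is rational when all entries of its hypermatrix are rational. -/
def MForm.IsRational {p : ℕ} {n : Fin p → ℕ} (A : MForm n) : Prop :=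
  ∀ k : ∀ i, Fin (n i), ∃ q : ℚ, A.entry k = (q : ℂ)

/-- The form `J` of the all-ones hypermatrix: `J(x₁, …, xₚ) = ∏ i, (sum of the entries of xᵢ)`. -/
noncomputable def allOnes {p : ℕ} (n : Fin p → ℕ) : MForm n :=
  (MultilinearMap.mkPiAlgebra ℂ (Fin p) ℂ).compLinearMap (fun _ => mass)

theorem allOnes_apply {p : ℕ} (n : Fin p → ℕ) (x : ∀ i, Fin (n i) → ℂ) :
    allOnes n x = ∏ i, ∑ k, x i k := by
  simp [allOnes, mass]

theorem allOnes_entry {p : ℕ} (n : Fin p → ℕ) (k : ∀ i, Fin (n i)) :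
    (allOnes n).entry k = 1 := by
  simp [MForm.entry, allOnes_apply]

/-- `T` is degenerate at the pure tensor `β₁ ⊗ ⋯ ⊗ βₚ`:
`T(β₁, …, βⱼ₋₁, x, βⱼ₊₁, …, βₚ) = 0` for every slot `j` and every vector `x`. -/
def MForm.IsDegenerateAt {p : ℕ} {n : Fin p → ℕ} (T : MForm n) (β : ∀ i, Fin (n i) → ℂ) : Prop :=
  ∀ (j : Fin p) (x : Fin (n j) → ℂ), T (Function.update β j x) = 0

/-- `α` is a mystery-value of `A`: there are vectors `βᵢ` of nonzero mass (the corresponding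
mystery-vectors) such that `α J - A` is degenerate at `β₁ ⊗ ⋯ ⊗ βₚ`. -/
def MForm.IsMysteryValue {p : ℕ} {n : Fin p → ℕ} (A : MForm n) (α : ℂ) : Prop :=
  ∃ β : ∀ i, Fin (n i) → ℂ, (α • allOnes n - A).IsDegenerateAt β ∧ ∀ i, mass (β i) ≠ 0

/-- The distribution of the bit `f(ω₁, …, ωₚ)`, when `ω₁, …, ωₚ` are sampled independently from
the finite probability spaces `(Ωᵢ, μᵢ)`. -/
noncomputable def bitLaw {p : ℕ} {Ω : Fin p → Type*} [∀ i, Finite (Ω i)]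
    [∀ i, MeasurableSpace (Ω i)] [∀ i, DiscreteMeasurableSpace (Ω i)]
    (f : (∀ i, Ω i) → Bool) (μ : ∀ i, ProbabilityMeasure (Ω i)) : ProbabilityMeasure Bool :=
  (ProbabilityMeasure.pi μ).map (f := f) Measurable.of_discrete.aemeasurable

/-- The function `f` of the independent sources `(Ωᵢ, μᵢ)` generates an `α`-biased bit robustly:
the bit is heads (`true`) with probability `α`, and the distribution of the bit does not change
when the distribution of any one of the sources is altered. -/
def GeneratesRobustly {p : ℕ} {Ω : Fin p → Type*} [∀ i, Finite (Ω i)]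
    [∀ i, MeasurableSpace (Ω i)] [∀ i, DiscreteMeasurableSpace (Ω i)]
    (f : (∀ i, Ω i) → Bool) (μ : ∀ i, ProbabilityMeasure (Ω i)) (α : ℝ) : Prop :=
  (bitLaw f μ {true} : ℝ) = α ∧
    ∀ (j : Fin p) (ν : ProbabilityMeasure (Ω j)), bitLaw f (Function.update μ j ν) = bitLaw f μ

/-! ### Derivations detect transcendental elements -/

/-! If `α` were transcendental, some `ℚ`-derivation `D` of `ℂ` would have `D α ≠ 0`. A rational form
obeys the Leibniz rule, so `D (A β)` is a sum of values of `A` at `β` with one vector changed. At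
such tuples degeneracy gives `A = α J`, hence `D (A β) = α * D (J β)`. But `A β = α * J β`, so `J β
* D α = 0`, contradicting the nonzero masses. For bits, the heads probability is a 0/1 form
evaluated at the probability vectors, and robustness against point masses is degeneracy. -/

theorem Algebra.FormallySmooth.of_field_of_charZero (K L : Type*) [Field K] [Field L] [CharZero K]
    [Algebra K L] : Algebra.FormallySmooth K L := by
  obtain ⟨ι, v, hv⟩ := exists_isTranscendenceBasis' K L
  have := hv.isAlgebraic_field
  exact .of_algebraicIndependent_of_isSeparable hv.1

theorem Algebra.FormallySmooth.of_injective_of_charZero (R L : Type*) [CommRing R] [IsDomain R]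
    [CharZero R] [Field L] [Algebra R L] (h : Function.Injective (algebraMap R L)) :
    Algebra.FormallySmooth R L := by
  have : FaithfulSMul R L := (faithfulSMul_iff_algebraMap_injective R L).2 h
  let : Algebra (FractionRing R) L := FractionRing.liftAlgebra R L
  have : CharZero (FractionRing R) := charZero_of_injective_algebraMap
    (IsFractionRing.injective R (FractionRing R))
  have := Algebra.FormallySmooth.of_field_of_charZero (FractionRing R) L
  have : Algebra.FormallyEtale R (FractionRing R) := .of_isLocalization (nonZeroDivisors R)
  exact .comp R (FractionRing R) L

/-- A transcendental element can be sent to any prescribed lift along a nilpotent thickening. -/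
theorem Transcendental.exists_algHom_section {K L B : Type*} [Field K] [CharZero K] [Field L]
    [Algebra K L] [CommRing B] [Algebra K B] (g : B →ₐ[K] L) (hg : Function.Surjective g)
    (hker : IsNilpotent (RingHom.ker g)) {x : L} (hx : Transcendental K x) (b : B)
    (hb : g b = x) : ∃ φ : L →ₐ[K] B, g.comp φ = AlgHom.id K L ∧ φ x = b := by
  -- With `X` acting as `x` on `L` and as `b` on `B`, any `K[X]`-linear section must send `x` to
  -- `b`.
  let : Algebra (Polynomial K) L := (Polynomial.aeval x).toAlgebra
  let : Algebra (Polynomial K) B := (Polynomial.aeval b).toAlgebra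
  have : IsScalarTower K (Polynomial K) L :=
    .of_algebraMap_eq fun r => ((Polynomial.aeval x).commutes r).symm
  have : IsScalarTower K (Polynomial K) B :=
    .of_algebraMap_eq fun r => ((Polynomial.aeval b).commutes r).symm
  have : Algebra.FormallySmooth (Polynomial K) L :=
    .of_injective_of_charZero _ _ (transcendental_iff_injective.1 hx)
  let g' : B →ₐ[Polynomial K] L :=
    { g with
      commutes' := fun P => by
        change g (Polynomial.aeval b P) = Polynomial.aeval x P
        rw [← hb, Polynomial.aeval_algHom_apply] }
  let φ := Algebra.FormallySmooth.liftOfSurjective (AlgHom.id (Polynomial K) L) g' hg hker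
  refine ⟨φ.restrictScalars K, AlgHom.ext fun y =>
    Algebra.FormallySmooth.liftOfSurjective_apply (AlgHom.id (Polynomial K) L) g' hg hker y, ?_⟩
  have h := φ.commutes Polynomial.X
  have hX : algebraMap (Polynomial K) L Polynomial.X = x := Polynomial.aeval_X x
  have hX' : algebraMap (Polynomial K) B Polynomial.X = b := Polynomial.aeval_X b
  rwa [hX, hX'] at h

/-- Sections of the dual numbers `L[ε] → L` have the form `y ↦ y + D y ε` with `D` a derivation;
lifting `x` to `x + ε` makes `D x = 1`. -/
theorem Transcendental.exists_derivation_ne_zero {K L : Type*} [Field K] [CharZero K] [Field L]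
    [Algebra K L] {x : L} (hx : Transcendental K x) : ∃ D : Derivation K L L, D x ≠ 0 := by
  have hker : IsNilpotent (RingHom.ker (TrivSqZeroExt.fstHom K L L)) :=
    ⟨2, TrivSqZeroExt.kerIdeal_sq L L⟩
  obtain ⟨φ, hφ, hφx⟩ := hx.exists_algHom_section (TrivSqZeroExt.fstHom K L L)
    (fun y => ⟨TrivSqZeroExt.inl y, rfl⟩) hker (TrivSqZeroExt.inl x + TrivSqZeroExt.inr 1)
    (by simp)
  have hfst (y : L) : (φ y).fst = y := DFunLike.congr_fun hφ y
  refine ⟨.mk' ((TrivSqZeroExt.sndHom L L).restrictScalars K ∘ₗ φ.toLinearMap) fun a b => ?_, ?_⟩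
  · simp [hfst, mul_comm]
  · simp [hφx]

theorem Derivation.map_prod {R A ι : Type*} [CommSemiring R] [CommSemiring A]
    [Algebra R A] [DecidableEq ι] (D : Derivation R A A) (s : Finset ι) (f : ι → A) :
    D (∏ i ∈ s, f i) = ∑ i ∈ s, (∏ j ∈ s.erase i, f j) * D (f i) := by
  induction s using Finset.induction_on with
  | empty => simp
  | insert a s ha ih =>
    rw [Finset.prod_insert ha, D.leibniz, ih, Finset.sum_insert ha, Finset.erase_insert ha,
      smul_eq_mul, smul_eq_mul, add_comm, Finset.mul_sum]
    congr 1
    refine Finset.sum_congr rfl fun i hi => ?_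
    have hia : a ≠ i := fun h => ha (h ▸ hi)
    rw [Finset.erase_insert_of_ne hia, Finset.prod_insert (fun h => ha (Finset.mem_of_mem_erase h)),
      mul_assoc]

/-! ### Hypermatrices and derivations -/

namespace MForm

variable {p : ℕ} {n : Fin p → ℕ}

theorem apply_eq_sum_entry (A : MForm n) (x : ∀ i, Fin (n i) → ℂ) :
    A x = ∑ k : (∀ i, Fin (n i)), (∏ i, x i (k i)) * A.entry k := by
  have hx : x = fun i => ∑ k, x i k • (Pi.single k 1 : Fin (n i) → ℂ) :=
    funext fun i => pi_eq_sum_univ' (x i)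
  conv_lhs => rw [hx, A.map_sum]
  exact Finset.sum_congr rfl fun k _ => A.map_smul_univ _ _

theorem isRational_allOnes (n : Fin p → ℕ) : (allOnes n).IsRational :=
  fun k => ⟨1, by simp [allOnes_entry]⟩

/-- `D` kills the rational entries, so only the coordinates of the vectors get differentiated. -/
theorem IsRational.derivation_apply {A : MForm n} (hA : A.IsRational) (D : Derivation ℚ ℂ ℂ)
    (β : ∀ i, Fin (n i) → ℂ) :
    D (A β) = ∑ j, A (Function.update β j (D ∘ β j)) := by
  simp_rw [A.apply_eq_sum_entry]
  rw [Finset.sum_comm, map_sum]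
  refine Finset.sum_congr rfl fun k _ => ?_
  obtain ⟨q, hq⟩ := hA k
  have hDq : D (q : ℂ) = 0 := D.map_algebraMap q
  rw [hq, D.leibniz, hDq, D.map_prod, smul_zero, zero_add, smul_eq_mul, mul_comm, Finset.sum_mul]
  refine Finset.sum_congr rfl fun j _ => ?_
  rw [← Finset.prod_erase_mul _ _ (Finset.mem_univ j)]
  congr 2
  · refine Finset.prod_congr rfl fun i hi => ?_
    rw [Function.update_of_ne (Finset.ne_of_mem_erase hi)]
  · simp

theorem IsMysteryValue.isAlgebraic {A : MForm n} (hp : 1 ≤ p) (hA : A.IsRational) {α : ℂ}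
    (hα : A.IsMysteryValue α) : IsAlgebraic ℚ α := by
  obtain ⟨β, hβ, hmass⟩ := hα
  by_contra htr
  obtain ⟨D, hD⟩ := Transcendental.exists_derivation_ne_zero htr
  have key (j : Fin p) (x : Fin (n j) → ℂ) :
      A (Function.update β j x) = α * allOnes n (Function.update β j x) :=
    (sub_eq_zero.1 (hβ j x)).symm
  -- A slot is needed to see `β` as an update of itself; for `p = 0` degeneracy is vacuous.
  have hval : A β = α * allOnes n β := by
    simpa using key ⟨0, hp⟩ (β ⟨0, hp⟩)
  have hder : D (A β) = α * D (allOnes n β) := by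
    rw [hA.derivation_apply, (isRational_allOnes n).derivation_apply, Finset.mul_sum]
    exact Finset.sum_congr rfl fun j _ => key j _
  rw [hval, D.leibniz, smul_eq_mul, smul_eq_mul, add_eq_left] at hder
  have hJ : allOnes n β ≠ 0 := by
    rw [allOnes_apply]
    exact Finset.prod_ne_zero_iff.2 fun i _ => hmass i
  exact (mul_ne_zero hJ hD) hder

end MForm

/-! ### Robustly generated bits and mystery-values -/

namespace MForm

variable {p : ℕ} {n : Fin p → ℕ}

/-- The multilinear form whose hypermatrix is `c`. -/
noncomputable def ofEntries (c : (∀ i, Fin (n i)) → ℂ) : MForm n :=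
  ∑ k, c k • (MultilinearMap.mkPiAlgebra ℂ (Fin p) ℂ).compLinearMap
    (fun i => LinearMap.proj (k i))

theorem ofEntries_apply (c : (∀ i, Fin (n i)) → ℂ) (x : ∀ i, Fin (n i) → ℂ) :
    ofEntries c x = ∑ k, c k * ∏ i, x i (k i) := by
  simp [ofEntries]

theorem entry_ofEntries (c : (∀ i, Fin (n i)) → ℂ) (k : ∀ i, Fin (n i)) :
    (ofEntries c).entry k = c k := by
  rw [entry, ofEntries_apply, Finset.sum_eq_single k]
  · simp
  · intro l _ hl
    obtain ⟨i, hi⟩ := Function.ne_iff.1 hl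
    rw [Finset.prod_eq_zero (Finset.mem_univ i) (by simp [hi]), mul_zero]
  · simp

/-- By linearity in each slot, basis vectors suffice; for bits these are the Dirac measures. -/
theorem isDegenerateAt_of_single {T : MForm n} {β : ∀ i, Fin (n i) → ℂ}
    (h : ∀ j k, T (Function.update β j (Pi.single k 1)) = 0) : T.IsDegenerateAt β := by
  intro j x
  have h0 : T.toLinearMap β j = 0 := by
    refine LinearMap.pi_ext' fun k => LinearMap.ext_ring ?_
    simpa using h j k
  exact DFunLike.congr_fun h0 x

end MForm

section Bits

variable {p : ℕ} {Ω : Fin p → Type*} [∀ i, Finite (Ω i)]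

/-- The multilinear form with entry `1` where the bit `f` is heads and entry `0` elsewhere. -/
noncomputable def headsForm (f : (∀ i, Ω i) → Bool) : MForm (fun i => Nat.card (Ω i)) :=
  MForm.ofEntries fun k => if f (fun i => (Finite.equivFin (Ω i)).symm (k i)) then 1 else 0

theorem isRational_headsForm (f : (∀ i, Ω i) → Bool) : (headsForm f).IsRational := by
  intro k
  rw [headsForm, MForm.entry_ofEntries]
  split_ifs
  · exact ⟨1, by simp⟩
  · exact ⟨0, by simp⟩

variable [∀ i, MeasurableSpace (Ω i)]

/-- The vectors of point probabilities of the finite probability spaces `(Ωᵢ, μᵢ)`. -/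
noncomputable def probVector (μ : ∀ i, ProbabilityMeasure (Ω i)) (i : Fin p)
    (k : Fin (Nat.card (Ω i))) : ℂ :=
  ((μ i : Measure (Ω i)).real {(Finite.equivFin (Ω i)).symm k} : ℂ)

variable [∀ i, DiscreteMeasurableSpace (Ω i)]

theorem mass_probVector (μ : ∀ i, ProbabilityMeasure (Ω i)) (i : Fin p) :
    mass (probVector μ i) = 1 := by
  have : Fintype (Ω i) := Fintype.ofFinite _
  change ∑ k, probVector μ i k = 1
  simp only [probVector]
  rw [Equiv.sum_comp (Finite.equivFin (Ω i)).symm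
    fun ω => ((μ i : Measure (Ω i)).real {ω} : ℂ), ← Complex.ofReal_sum,
    sum_measureReal_singleton, Finset.coe_univ, probReal_univ, Complex.ofReal_one]

theorem probVector_update_dirac (μ : ∀ i, ProbabilityMeasure (Ω i)) (j : Fin p)
    (k : Fin (Nat.card (Ω j))) :
    probVector (Function.update μ j (diracProba ((Finite.equivFin (Ω j)).symm k))) =
      Function.update (probVector μ) j (Pi.single k 1) := by
  funext i l
  by_cases hij : i = j
  · subst hij
    rw [probVector, Function.update_self, Function.update_self, diracProba]
    by_cases hlk : l = k
    · subst hlk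
      simp [Measure.real]
    · simp [Measure.real, hlk, Ne.symm hlk]
  · rw [probVector, Function.update_of_ne hij, Function.update_of_ne hij, probVector]

theorem bitLaw_true_eq_headsForm (f : (∀ i, Ω i) → Bool) (μ : ∀ i, ProbabilityMeasure (Ω i)) :
    ((bitLaw f μ {true} : ℝ) : ℂ) = headsForm f (probVector μ) := by
  classical
  have (i : Fin p) : Fintype (Ω i) := Fintype.ofFinite _
  have h1 : (bitLaw f μ {true} : ℝ) =
      (Measure.pi fun i => (μ i : Measure (Ω i))).real (f ⁻¹' {true}) := by
    change ((bitLaw f μ : Measure Bool) {true}).toReal = _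
    rw [bitLaw, ProbabilityMeasure.toMeasure_map,
      Measure.map_apply Measurable.of_discrete (MeasurableSet.of_discrete)]
    rfl
  have h2 : f ⁻¹' {true} = ((Finset.univ.filter fun ω => f ω = true : Finset (∀ i, Ω i)) :
      Set (∀ i, Ω i)) := by
    ext ω
    simp
  rw [h1, h2, ← sum_measureReal_singleton, headsForm, MForm.ofEntries_apply,
    Finset.sum_filter, Complex.ofReal_sum,
    ← Equiv.sum_comp (Equiv.piCongrRight fun i => (Finite.equivFin (Ω i)).symm)]
  refine Finset.sum_congr rfl fun k _ => ?_
  have h3 : (Measure.pi fun i => (μ i : Measure (Ω i))).real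
      {fun i => (Finite.equivFin (Ω i)).symm (k i)} =
      ∏ i, (μ i : Measure (Ω i)).real {(Finite.equivFin (Ω i)).symm (k i)} := by
    rw [Measure.real, Measure.pi_singleton, ENNReal.toReal_prod]
    rfl
  have h4 : Equiv.piCongrRight (fun i => (Finite.equivFin (Ω i)).symm) k =
      fun i => (Finite.equivFin (Ω i)).symm (k i) := rfl
  rw [h4, h3]
  split_ifs <;> simp [probVector]

theorem GeneratesRobustly.isMysteryValue {f : (∀ i, Ω i) → Bool}
    {μ : ∀ i, ProbabilityMeasure (Ω i)} {α : ℝ} (h : GeneratesRobustly f μ α) :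
    (headsForm f).IsMysteryValue α := by
  refine ⟨probVector μ, MForm.isDegenerateAt_of_single fun j k => ?_, fun i => ?_⟩
  · rw [← probVector_update_dirac, sub_apply, smul_apply,
      ← bitLaw_true_eq_headsForm, h.2 j, h.1, allOnes_apply]
    have hmass (ν : ∀ i, ProbabilityMeasure (Ω i)) (i : Fin p) : ∑ k, probVector ν i k = 1 :=
      mass_probVector ν i
    simp [hmass]
  · simp [mass_probVector]

/-- Without sources the bit is constant, so `α` is 0 or 1; mystery-values carry no information here.
-/
theorem GeneratesRobustly.isAlgebraic_of_fin_zero {Ω : Fin 0 → Type*} [∀ i, Finite (Ω i)]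
    [∀ i, MeasurableSpace (Ω i)] [∀ i, DiscreteMeasurableSpace (Ω i)] {f : (∀ i, Ω i) → Bool}
    {μ : ∀ i, ProbabilityMeasure (Ω i)} {α : ℝ} (h : GeneratesRobustly f μ α) :
    IsAlgebraic ℚ (α : ℂ) := by
  rw [← h.1, bitLaw_true_eq_headsForm, headsForm, MForm.ofEntries_apply]
  simp only [Finset.univ_unique, Finset.sum_singleton, Finset.univ_eq_empty, Finset.prod_empty,
    mul_one]
  split_ifs
  · exact isAlgebraic_one
  · exact isAlgebraic_zero

end Bits

theorem mainTheorem3 :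
    (∀ (p : ℕ) (_ : 1 ≤ p) (n : Fin p → ℕ) (A : MForm n), A.IsRational →
      ∀ α : ℂ, A.IsMysteryValue α → IsAlgebraic ℚ α) ∧
    (∀ (p : ℕ) (Ω : Fin p → Type*) [∀ i, Finite (Ω i)] [∀ i, MeasurableSpace (Ω i)]
      [∀ i, DiscreteMeasurableSpace (Ω i)] (f : (∀ i, Ω i) → Bool)
      (μ : ∀ i, ProbabilityMeasure (Ω i)) (α : ℝ),
      Transcendental ℚ α → ¬ GeneratesRobustly f μ α) := by
  refine ⟨fun p hp n A hA α hα => hα.isAlgebraic hp hA, ?_⟩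
  intro p Ω _ _ _ f μ α htr h
  have halg : IsAlgebraic ℚ (α : ℂ) := by
    rcases Nat.eq_zero_or_pos p with rfl | hp
    · exact h.isAlgebraic_of_fin_zero
    · exact h.isMysteryValue.isAlgebraic hp (isRational_headsForm f)
  exact htr ((isAlgebraic_algebraMap_iff (algebraMap ℝ ℂ).injective).1 halg)
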